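/- Let $F$ be a field of characteristic zero, let $m\ge 1$, and let $\mathbf G=(G_1,\dots,G_m)$ be a sequence of simple graphs, each with at least one edge, on a common vertex set $V$ with $|V|=n$. For $r\ge -1$ let $\Delta_r(\mathbf G)$ be the set of ordered partitions $(B_1,\dots,B_{r+2})$ of $V$ into nonempty blocks such that for every $i$ at least one block contains an edge of $G_i$; these are the $r$-dimensional faces of the intersection $\Delta(\mathbf G)=\bigcap_i\Delta(G_i)$ of the coloring complexes. Let $C_r$ be the $F$-vector space with basis $\Delta_r(\mathbf G)$, and let $$\partial_r(B_1,\dots,B_{r+2})=\sum_{i=1}^{r+1}(-1)^i(B_1,\dots,B_i\cup B_{i+1},\dots,B_{r+2}).$$ The symmetric group $S_{r+2}$ acts on $C_r$ by $\sigma\cdot(B_1,\dots,B_{r+2})=(B_{\sigma^{-1}(1)},\dots,B_{\sigma^{-1}(r+2)})$. The Eulerian idempotents $e_k^{(j)}\in F[S_k]$ are defined by the polynomial identity $$\sum_{j} t^j e_k^{(j)}=\sum_{\pi\in S_k}\binom{k+t-\mathrm{des}(\pi)-1}{k}\,\mathrm{sgn}(\pi)\,\pi ,$$ where $\mathrm{des}(\pi)$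 is the number of $i$ with $\pi(i)>\pi(i+1)$. Put $C_r^{(j)}=e_{r+2}^{(j)}C_r$. Let $\chi_{\mathbf G}$ be the polynomial whose value at each $q\in\mathbb N$ is the number of maps $V\to\{1,\dots,q\}$ that are proper colorings of at least one $G_i$. **Theorem.** For each $j$, the spaces $C_*^{(j)}$ form a subcomplex of $(C_*,\partial_*)$, that is, $\partial_r(C_r^{(j)})\subseteq C_{r-1}^{(j)}$ for all $r$ (with $C_{-2}=0$). Let $H_*^{(j)}$ denote its homology. Then its Euler characteristic satisfies $$\sum_{r=-1}^{n-3}(-1)^r\dim C_r^{(j)}=\sum_{r=-1}^{n-3}(-1)^r\dim H_r^{(j)}=-[\lambda^j]\bigl(\chi_{\mathbf G}(-\lambda)-(-\lambda)^n\bigr),$$ where $[\lambda^j]$ denotes the coefficient of $\lambda^j$. -/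

import Mathlib

open Polynomial

namespace ColoringComplex

/-- An ordered partition `(B_0, …, B_{k-1})` of `V` into `k` nonempty blocks, recorded by the
surjection `V → Fin k` that sends a vertex to the index of its block. -/
def OrderedPartition (V : Type*) (k : ℕ) : Type _ :=
  {f : V → Fin k // Function.Surjective f}

namespace OrderedPartition

/-- The `p`-th block. -/
def block {V : Type*} {k : ℕ} (B : OrderedPartition V k) (p : Fin k) : Set V :=
  {v | B.1 v = p}

/-- Ordered partitions are the same as families of nonempty pairwise disjoint blocks
covering `V`. -/
theorem existsUnique_block_eq {V : Type*} {k : ℕ} (S : Fin k → Set V) :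
    ((∀ p, (S p).Nonempty) ∧ Pairwise (Function.onFun Disjoint S) ∧ ⋃ p, S p = Set.univ) ↔
      ∃! B : OrderedPartition V k, B.block = S := by
  constructor
  · rintro ⟨hne, hd, hU⟩
    have hex : ∀ v, ∃ p, v ∈ S p := fun v => by
      have : v ∈ ⋃ p, S p := hU ▸ Set.mem_univ v
      simpa using this
    choose f hf using hex
    have key : ∀ v p, f v = p ↔ v ∈ S p := fun v p => by
      constructor
      · rintro rfl
        exact hf v
      · intro h
        by_contra hne'
        exact Set.disjoint_left.1 (hd hne') (hf v) h
    refine ⟨⟨f, fun p => ?_⟩, ?_, ?_⟩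
    · obtain ⟨v, hv⟩ := hne p
      exact ⟨v, (key v p).2 hv⟩
    · funext p
      ext v
      exact key v p
    · rintro ⟨g, hg⟩ h
      apply Subtype.ext
      funext v
      have h1 : v ∈ S (g v) := by
        rw [← h]
        rfl
      exact ((key v _).2 h1).symm
  · rintro ⟨B, rfl, -⟩
    refine ⟨fun p => B.2 p, fun p q hpq => ?_, ?_⟩
    · exact Set.disjoint_left.2 fun v hv hw => hpq (hv.symm.trans hw)
    · ext v
      simp [block]

/-- `σ • (B_0, …, B_{k-1}) = (B_{σ⁻¹ 0}, …, B_{σ⁻¹ (k-1)})`; see `block_smul`. -/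
instance {V : Type*} {k : ℕ} : MulAction (Equiv.Perm (Fin k)) (OrderedPartition V k) where
  smul σ B := ⟨fun v => σ (B.1 v), σ.surjective.comp B.2⟩
  one_smul _ := rfl
  mul_smul _ _ _ := rfl

theorem block_smul {V : Type*} {k : ℕ} (σ : Equiv.Perm (Fin k)) (B : OrderedPartition V k)
    (p : Fin k) : (σ • B).block p = B.block (σ⁻¹ p) := by
  ext v
  exact (Equiv.eq_symm_apply σ).symm

/-- Replace the two consecutive blocks `B_p`, `B_{p+1}` by their union
(`Fin.predAbove p` identifies `p` and `p + 1` and is otherwise strictly increasing). -/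
def merge {V : Type*} {k : ℕ} (p : Fin k) (B : OrderedPartition V (k + 1)) :
    OrderedPartition V k :=
  ⟨fun v => p.predAbove (B.1 v), (Fin.predAbove_surjective p).comp B.2⟩

theorem val_predAbove {k : ℕ} (p : Fin k) (x : Fin (k + 1)) :
    (p.predAbove x : ℕ) = if (p : ℕ) < x then (x : ℕ) - 1 else x := by
  unfold Fin.predAbove
  simp only [Fin.lt_def, Fin.val_castSucc]
  split_ifs <;> simp

theorem block_merge {V : Type*} {k : ℕ} (p : Fin k) (B : OrderedPartition V (k + 1))
    (q : Fin k) : (B.merge p).block q =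
      if q < p then B.block q.castSucc
      else if q = p then B.block p.castSucc ∪ B.block p.succ
      else B.block q.succ := by
  ext v
  have h : v ∈ (merge p B).block q ↔ p.predAbove (B.1 v) = q := Iff.rfl
  rw [h]
  split_ifs with h1 h2 <;>
    simp only [block, Set.mem_union, Set.mem_ofPred_eq, val_predAbove, Fin.ext_iff,
      Fin.lt_def, Fin.val_castSucc, Fin.val_succ] at * <;>
    split_ifs <;> omega

end OrderedPartition

/-- The ordered partitions of `V` into `k` blocks, at least one of which contains an edge of `G`.
These are the faces of dimension `k - 2` of the coloring complex of `G`. -/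
def coloringFaces {V : Type*} (G : SimpleGraph V) (k : ℕ) : Set (OrderedPartition V k) :=
  {B | ∃ p, ∃ v ∈ B.block p, ∃ w ∈ B.block p, G.Adj v w}

/-- The faces with `k` blocks (of dimension `k - 2`) of the intersection of the coloring complexes
of `G_1, …, G_m`. -/
def interFaces {V : Type*} {m : ℕ} (G : Fin m → SimpleGraph V) (k : ℕ) :
    Set (OrderedPartition V k) :=
  ⋂ i, coloringFaces (G i) k

theorem smul_mem_interFaces {V : Type*} {m : ℕ} {G : Fin m → SimpleGraph V} {k : ℕ}
    (σ : Equiv.Perm (Fin k)) {B : OrderedPartition V k} (hB : B ∈ interFaces G k) :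
    σ • B ∈ interFaces G k := by
  refine Set.mem_iInter.2 fun i => ?_
  obtain ⟨p, v, hv, w, hw, h⟩ := Set.mem_iInter.1 hB i
  exact ⟨σ p, v, congrArg σ hv, w, congrArg σ hw, h⟩

theorem merge_mem_interFaces {V : Type*} {m : ℕ} {G : Fin m → SimpleGraph V} {k : ℕ}
    (p : Fin k) {B : OrderedPartition V (k + 1)} (hB : B ∈ interFaces G (k + 1)) :
    B.merge p ∈ interFaces G k := by
  refine Set.mem_iInter.2 fun i => ?_
  obtain ⟨q, v, hv, w, hw, h⟩ := Set.mem_iInter.1 hB i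
  exact ⟨p.predAbove q, v, congrArg p.predAbove hv, w, congrArg p.predAbove hw, h⟩

instance {V : Type*} {m : ℕ} (G : Fin m → SimpleGraph V) (k : ℕ) :
    MulAction (Equiv.Perm (Fin k)) (interFaces G k) where
  smul σ B := ⟨σ • B.1, smul_mem_interFaces σ B.2⟩
  one_smul _ := rfl
  mul_smul _ _ _ := rfl

/-- The chain space `C_{k-2}` of the intersection of the coloring complexes: the `F`-vector space
with basis the faces with `k` blocks. -/
abbrev Chain (F : Type*) [Field F] {V : Type*} {m : ℕ} (G : Fin m → SimpleGraph V) (k : ℕ) :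
    Type _ :=
  interFaces G k →₀ F

/-- The boundary map `∂ (B_1, …, B_{k+1}) = ∑_{i=1}^{k} (-1)^i (B_1, …, B_i ∪ B_{i+1}, …, B_{k+1})`
(here `i = p + 1`, as blocks are indexed from `0`). -/
noncomputable def boundary (F : Type*) [Field F] {V : Type*} {m : ℕ} (G : Fin m → SimpleGraph V)
    (k : ℕ) : Chain F G (k + 1) →ₗ[F] Chain F G k :=
  ∑ p : Fin k, (-1 : F) ^ ((p : ℕ) + 1) •
    Finsupp.lmapDomain F F fun B : interFaces G (k + 1) =>
      (⟨B.1.merge p, merge_mem_interFaces p B.2⟩ : interFaces G k)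

theorem boundary_single (F : Type*) [Field F] {V : Type*} {m : ℕ} (G : Fin m → SimpleGraph V)
    (k : ℕ) (B : interFaces G (k + 1)) (a : F) :
    boundary F G k (Finsupp.single B a) = ∑ p : Fin k, (-1 : F) ^ ((p : ℕ) + 1) •
      Finsupp.single (⟨B.1.merge p, merge_mem_interFaces p B.2⟩ : interFaces G k) a := by
  simp [boundary, LinearMap.sum_apply]

theorem merge_merge {V : Type*} {k : ℕ} (B : OrderedPartition V (k + 2)) {i j : Fin k}
    (h : i ≤ j) : (B.merge i.castSucc).merge j = (B.merge j.succ).merge i := by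
  apply Subtype.ext
  funext v
  change j.predAbove (i.castSucc.predAbove (B.1 v)) = i.predAbove (j.succ.predAbove (B.1 v))
  generalize B.1 v = x
  simp only [OrderedPartition.val_predAbove, Fin.ext_iff, Fin.le_def, Fin.val_castSucc,
    Fin.val_succ] at *
  split_ifs <;> omega

theorem boundary_comp_boundary (F : Type*) [Field F] {V : Type*} {m : ℕ}
    (G : Fin m → SimpleGraph V) (k : ℕ) : boundary F G k ∘ₗ boundary F G (k + 1) = 0 := by
  apply Finsupp.lhom_ext
  intro B a
  simp only [LinearMap.comp_apply, boundary_single, map_sum, map_smul, LinearMap.zero_apply,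
    Finset.smul_sum, smul_smul, ← pow_add]
  rw [← Finset.sum_product']
  have hlt : ∀ x : Fin (k + 1) × Fin k, ¬ (x.1 : ℕ) ≤ x.2 → (x.1 : ℕ) - 1 < k := by omega
  refine Finset.sum_involution
    (fun x _ => if h : (x.1 : ℕ) ≤ x.2 then (x.2.succ, ⟨x.1, h.trans_lt x.2.2⟩)
      else (x.2.castSucc, ⟨(x.1 : ℕ) - 1, hlt x h⟩)) ?_ ?_ ?_ ?_
  · rintro ⟨p, q⟩ -
    by_cases h : (p : ℕ) ≤ q
    · have hm := merge_merge B.1 (i := ⟨p, h.trans_lt q.2⟩) (j := q) h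
      simp only [dif_pos h]
      have hp : (Fin.castSucc ⟨p, h.trans_lt q.2⟩ : Fin (k + 1)) = p := rfl
      rw [hp] at hm
      simp only [hm, ← add_smul]
      convert zero_smul F _
      simp only [Fin.val_succ]
      ring
    · have hm := merge_merge B.1 (i := q) (j := ⟨(p : ℕ) - 1, hlt (p, q) h⟩)
        (Fin.le_def.2 (Nat.le_sub_one_of_lt (not_le.1 h)))
      simp only [dif_neg h]
      have hp : (Fin.succ ⟨(p : ℕ) - 1, hlt (p, q) h⟩ : Fin (k + 1)) = p := by
        ext
        rw [Fin.val_succ]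
        exact Nat.sub_add_cancel (by omega)
      rw [hp] at hm
      simp only [hm, ← add_smul]
      convert zero_smul F _
      obtain ⟨s, hs⟩ : ∃ s, (p : ℕ) = s + 1 := ⟨p - 1, by omega⟩
      simp only [Fin.val_castSucc, hs, Nat.add_sub_cancel]
      ring
  · rintro ⟨p, q⟩ - -
    by_cases h : (p : ℕ) ≤ q
    · simp only [dif_pos h, ne_eq, Prod.mk.injEq, Fin.ext_iff, Fin.val_succ]
      omega
    · simp only [dif_neg h, ne_eq, Prod.mk.injEq, Fin.ext_iff, Fin.val_castSucc]
      rintro ⟨h1, h2⟩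
      omega
  · simp
  · rintro ⟨p, q⟩ -
    by_cases h : (p : ℕ) ≤ q
    · have h' : ¬ ((q.succ : Fin (k + 1)) : ℕ) ≤ p := by
        rw [Fin.val_succ]
        omega
      simp only [dif_pos h, dif_neg h']
      simp
    · have h' : ((q.castSucc : Fin (k + 1)) : ℕ) ≤ (p : ℕ) - 1 := by
        rw [Fin.val_castSucc]
        omega
      simp only [dif_neg h, dif_pos h']
      exact Prod.ext (Fin.ext (Nat.sub_add_cancel (by omega))) (Fin.ext rfl)

/-- The representation of the symmetric group on the chain space, permuting the blocks. -/
noncomputable def chainRep (F : Type*) [Field F] {V : Type*} {m : ℕ} (G : Fin m → SimpleGraph V)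
    (k : ℕ) : Representation F (Equiv.Perm (Fin k)) (Chain F G k) where
  toFun σ := Finsupp.lmapDomain F F (σ • ·)
  map_one' := by
    ext
    simp
  map_mul' σ τ := by
    ext
    simp [mul_smul]

/-- The number of descents of `π`: couples of consecutive numbers `(i, i+1)` with
`π i > π (i+1)`. -/
def des {k : ℕ} (π : Equiv.Perm (Fin k)) : ℕ :=
  (Finset.univ.filter fun x : Fin k × Fin k => (x.2 : ℕ) = x.1 + 1 ∧ π x.2 < π x.1).card

/-- The binomial coefficient `binom(k + t - d - 1, k)` as a polynomial in the variable `t`. -/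
noncomputable def binomPoly (F : Type*) [Field F] (k d : ℕ) : F[X] :=
  C ((k.factorial : F)⁻¹) * (descPochhammer F k).comp (X + C ((k : F) - d - 1))

theorem eval_binomPoly (F : Type*) [Field F] [CharZero F] (k d t : ℕ) (h : d + 1 ≤ k + t) :
    (binomPoly F k d).eval (t : F) = ((k + t - d - 1).choose k : F) := by
  have h1 : (t : F) + ((k : F) - d - 1) = ((k + t - d - 1 : ℕ) : F) := by
    rw [Nat.sub_sub, Nat.cast_sub h]
    push_cast
    ring
  have h2 : (k.factorial : F) ≠ 0 := by exact_mod_cast k.factorial_ne_zero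
  simp only [binomPoly, eval_mul, eval_C, eval_comp, eval_add, eval_X, h1,
    descPochhammer_eval_eq_descFactorial, Nat.descFactorial_eq_factorial_mul_choose]
  push_cast
  field_simp

/-- The Eulerian idempotent `e_k^{(j)}` of the group algebra of the symmetric group: the coefficient
of `t^j` in `∑_π binom(k + t - des π - 1, k) sgn(π) π`. -/
noncomputable def eulerianIdempotent (F : Type*) [Field F] (k j : ℕ) :
    MonoidAlgebra F (Equiv.Perm (Fin k)) :=
  ∑ π : Equiv.Perm (Fin k), MonoidAlgebra.single π
    ((binomPoly F k (des π)).coeff j * ((Equiv.Perm.sign π : ℤ) : F))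

/-- The `j`-th Hodge piece `C_{k-2}^{(j)} = e_k^{(j)} C_{k-2}` of the chain space `C_{k-2}`. -/
noncomputable def hodgeChain (F : Type*) [Field F] {V : Type*} {m : ℕ} (G : Fin m → SimpleGraph V)
    (j k : ℕ) : Submodule F (Chain F G k) :=
  LinearMap.range ((chainRep F G k).asAlgebraHom (eulerianIdempotent F k j))

/-- The cycles of degree `k - 1` (faces with `k + 1` blocks) of the `j`-th Hodge subcomplex. -/
noncomputable def hodgeCycles (F : Type*) [Field F] {V : Type*} {m : ℕ}
    (G : Fin m → SimpleGraph V) (j k : ℕ) : Submodule F (Chain F G (k + 1)) :=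
  hodgeChain F G j (k + 1) ⊓ LinearMap.ker (boundary F G k)

/-- The boundaries of degree `k - 1` (faces with `k + 1` blocks) of the `j`-th Hodge subcomplex. -/
noncomputable def hodgeBoundaries (F : Type*) [Field F] {V : Type*} {m : ℕ}
    (G : Fin m → SimpleGraph V) (j k : ℕ) : Submodule F (Chain F G (k + 1)) :=
  (hodgeChain F G j (k + 2)).map (boundary F G (k + 1))

/-- The quotient `Z / B` of two subspaces of a vector space (used with `B ≤ Z`). -/
abbrev Subquotient {F M : Type*} [Field F] [AddCommGroup M] [Module F M] (Z B : Submodule F M) :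
    Type _ :=
  Z ⧸ B.submoduleOf Z

/-- The homology `H_{k-1}^{(j)}` of the `j`-th Hodge subcomplex: cycles modulo boundaries. -/
abbrev HodgeHomology (F : Type*) [Field F] {V : Type*} {m : ℕ} (G : Fin m → SimpleGraph V)
    (j k : ℕ) : Type _ :=
  Subquotient (hodgeCycles F G j k) (hodgeBoundaries F G j k)

/-- The Euler characteristic `∑_{r=-1}^{n-3} (-1)^r dim C_r^{(j)}` of the `j`-th Hodge subcomplex,
where `n` is the number of vertices; here `r = k - 1`, with `r + 2 = k + 1` blocks. -/
noncomputable def hodgeEulerChar (F : Type*) [Field F] {V : Type*} [Fintype V] {m : ℕ}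
    (G : Fin m → SimpleGraph V) (j : ℕ) : ℤ :=
  ∑ k ∈ Finset.range (Fintype.card V - 1),
    (-1) ^ (k + 1) * (Module.finrank F (hodgeChain F G j (k + 1)) : ℤ)

/-- The number of colorings of `V` with `q` colors that are proper for at least one `G_i`. -/
noncomputable def numColorings {V : Type*} {m : ℕ} (G : Fin m → SimpleGraph V) (q : ℕ) : ℕ :=
  Nat.card {c : V → Fin q // ∃ i, ∀ v w, (G i).Adj v w → c v ≠ c w}

theorem exists_chromaticPolynomial {V : Type*} [Finite V] {m : ℕ} (G : Fin m → SimpleGraph V) :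
    ∃ P : ℤ[X], ∀ q : ℕ, P.eval (q : ℤ) = numColorings G q := by
  classical
  have := Fintype.ofFinite V
  let good : Setoid V → Prop := fun s => ∃ i, ∀ v w, (G i).Adj v w → ¬ s v w
  have hfin : Finite (Setoid V) :=
    Finite.of_injective (fun s : Setoid V => (fun v w => s v w : V → V → Prop))
      fun s t h => Setoid.ext fun v w => iff_of_eq (congrFun (congrFun h v) w)
  have := Fintype.ofFinite {s : Setoid V // good s}
  refine ⟨∑ s : {s : Setoid V // good s}, descPochhammer ℤ (Nat.card (Quotient s.1)), fun q => ?_⟩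
  -- a coloring is a partition of `V` together with an injective coloring of its blocks
  let e : {c : V → Fin q // ∃ i, ∀ v w, (G i).Adj v w → c v ≠ c w} ≃
      Σ s : {s : Setoid V // good s}, (Quotient s.1 ↪ Fin q) :=
    { toFun := fun c => ⟨⟨Setoid.ker c.1, c.2⟩,
        ⟨Quotient.lift c.1 fun _ _ h => h, by
          rintro ⟨v⟩ ⟨w⟩ h
          exact Quotient.sound h⟩⟩
      invFun := fun x => ⟨fun v => x.2 (Quotient.mk x.1.1 v), by
        obtain ⟨i, hi⟩ := x.1.2
        exact ⟨i, fun v w h h' => hi v w h (Quotient.exact (x.2.injective h'))⟩⟩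
      left_inv := fun c => rfl
      right_inv := by
        rintro ⟨⟨s, hs⟩, g⟩
        have hker : Setoid.ker (fun v => g (Quotient.mk s v)) = s := Setoid.ext fun v w =>
          ⟨fun h => Quotient.exact (g.injective h), fun h => congrArg g (Quotient.sound h)⟩
        have key : ∀ (t : Setoid V) (_ : t = s) (ht : good t) (g' : Quotient t ↪ Fin q),
            (∀ v, g' (Quotient.mk t v) = g (Quotient.mk s v)) →
              (⟨⟨t, ht⟩, g'⟩ : Σ s : {s : Setoid V // good s}, (Quotient s.1 ↪ Fin q)) =
                ⟨⟨s, hs⟩, g⟩ := by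
          rintro t rfl ht g' h
          congr 1
          ext x
          induction x using Quotient.inductionOn with
          | h v => rw [h v]
        exact key _ hker _ _ fun v => rfl }
  rw [numColorings, Nat.card_congr e, Nat.card_sigma, eval_finsetSum]
  push_cast
  refine Finset.sum_congr rfl fun s _ => ?_
  have := Fintype.ofFinite (Quotient s.1)
  rw [descPochhammer_eval_eq_descFactorial, Nat.card_eq_fintype_card, Nat.card_eq_fintype_card,
    Fintype.card_embedding_eq, Fintype.card_fin]

/-- The chromatic polynomial of the sequence `G_1, …, G_m`: the unique polynomial whose value at
every natural number `q` is the number of colorings of `V` with `q` colors that are proper for at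
least one `G_i`. -/
noncomputable def chromaticPolynomial {V : Type*} [Finite V] {m : ℕ} (G : Fin m → SimpleGraph V) :
    ℤ[X] :=
  (exists_chromaticPolynomial G).choose

theorem eq_chromaticPolynomial_iff {V : Type*} [Finite V] {m : ℕ} (G : Fin m → SimpleGraph V)
    (P : ℤ[X]) :
    P = chromaticPolynomial G ↔ ∀ q : ℕ, P.eval (q : ℤ) = numColorings G q := by
  have spec := (exists_chromaticPolynomial G).choose_spec
  refine ⟨fun h => h ▸ spec, fun h => ?_⟩
  refine Polynomial.eq_of_infinite_eval_eq _ _ ?_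
  refine (Set.infinite_range_of_injective (Nat.cast_injective (R := ℤ))).mono ?_
  rintro _ ⟨q, rfl⟩
  exact (h q).trans (spec q).symm

end ColoringComplex

/-! Everything rests on reading the generating function of the Eulerian idempotents as a sum over
words. Exactly `binom(k + t - des π - 1, k)` words of length `k` in `t` ordered letters have stable
sorting permutation `π` (`card_sort_eq`), so `S_k(t) = ∑_j t^j e_k^{(j)}` is the signed sum of the
sorting permutations of all words (`sortSum_eq`). Polynomial identities in `t` can thus be proved
bijectively for positive integers `t` and then split into coefficients (`sum_coeff_smul_eq`).

Sorting by two keys in succession is sorting by pairs, so `S_k(s) S_k(t) = S_k(st)`, which makes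
each `e_k^{(j)}` idempotent. A sign-reversing involution gives `∂ S_{k+1}(t) = S_k(t) ∂`
(`boundary_comp_sortSum`), hence `∂` commutes with the idempotents and the Hodge pieces form
subcomplexes.

The dimension of a piece is the trace of its idempotent. Permutations act freely on faces, so only
`π = 1` contributes: the number of faces times `[t^j] binom(k + t - 1, k)` (`finrank_hodgeChain`).
Colorings improper for every `G_i` are counted by `q^n - χ(q) = ∑_k #faces_k binom(q, k)`, and the
reciprocity `(-1)^k binom(k + t - 1, k) = binom(-t, k)` matches the two sums. The homological form
is the usual telescoping of ranks. -/

namespace ColoringComplex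

/-! ### Stable sorting permutations of words. -/

section Sorting

variable {k : ℕ} {α β : Type*} [LinearOrder α] [LinearOrder β]

theorem sort_comp_strictMono (c : Fin k → α) {e : α → β} (he : StrictMono e) :
    Tuple.sort (e ∘ c) = Tuple.sort c := by
  refine (Tuple.eq_sort_iff.2 ⟨?_, ?_⟩).symm
  · exact he.monotone.comp (Tuple.monotone_sort c)
  · intro i j hij h
    exact (Tuple.eq_sort_iff.1 (rfl : Tuple.sort c = Tuple.sort c)).2 i j hij (he.injective h)

/-- Radix sort: sort stably by the minor key `c`, then by the major key `d`, which is attached to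
the positions in the already sorted word. Ties in `d` keep the order created by `c`. -/
theorem sort_mul_sort (c : Fin k → α) (d : Fin k → β) :
    Tuple.sort c * Tuple.sort d =
      Tuple.sort fun p => toLex (d ((Tuple.sort c).symm p), c p) := by
  obtain ⟨hc, hc'⟩ := Tuple.eq_sort_iff.1 (rfl : Tuple.sort c = Tuple.sort c)
  obtain ⟨hd, hd'⟩ := Tuple.eq_sort_iff.1 (rfl : Tuple.sort d = Tuple.sort d)
  refine Tuple.eq_sort_iff.2 ⟨?_, ?_⟩
  · intro i j hij
    rcases hij.eq_or_lt with rfl | hlt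
    · exact le_rfl
    simp only [Function.comp_apply, Equiv.Perm.mul_apply, Equiv.symm_apply_apply,
      Prod.Lex.toLex_le_toLex]
    rcases (hd hij).lt_or_eq with h | h
    · exact Or.inl h
    · exact Or.inr ⟨h, hc (hd' i j hlt h).le⟩
  · intro i j hij h
    simp only [Equiv.Perm.mul_apply, Equiv.symm_apply_apply, EmbeddingLike.apply_eq_iff_eq,
      Prod.mk.injEq] at h ⊢
    exact hc' _ _ (hd' i j hij h.1) h.2

/-- The swap reverses the relative order of the two adjacent positions only, and these carry
different letters, so no tie is broken differently. -/
theorem sort_comp_swap (c : Fin (k + 1) → α) (p : Fin k) (h : c p.castSucc ≠ c p.succ) :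
    Tuple.sort (c ∘ Equiv.swap p.castSucc p.succ) =
      Equiv.swap p.castSucc p.succ * Tuple.sort c := by
  obtain ⟨hc, hc'⟩ := Tuple.eq_sort_iff.1 (rfl : Tuple.sort c = Tuple.sort c)
  refine (Tuple.eq_sort_iff.2 ⟨?_, ?_⟩).symm
  · intro i j hij
    simpa using hc hij
  · intro i j hij hs
    simp only [Equiv.Perm.mul_apply, Function.comp_apply, Equiv.swap_apply_self] at hs ⊢
    have hlt := hc' i j hij hs
    revert hs hlt
    generalize Tuple.sort c i = x
    generalize Tuple.sort c j = y
    intro hs hlt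
    have hne : ¬ (x = p.castSucc ∧ y = p.succ) := by
      rintro ⟨rfl, rfl⟩
      exact h hs
    simp only [Equiv.swap_apply_def]
    simp only [Fin.ext_iff, Fin.lt_def, Fin.val_castSucc, Fin.val_succ] at *
    split_ifs <;> try simp only [Fin.val_castSucc, Fin.val_succ]
    all_goals omega

theorem predAbove_succ_succAbove (p y : Fin k) : p.predAbove (p.succ.succAbove y) = y := by
  simp only [Fin.succAbove, Fin.ext_iff, OrderedPartition.val_predAbove, Fin.lt_def]
  split_ifs <;> simp_all <;> omega

/-- The permutation of `Fin (k + 1)` sending `q.succ` to `p.succ` and acting like `σ` on the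
remaining elements. -/
def doublePerm (σ : Equiv.Perm (Fin k)) (p q : Fin k) : Equiv.Perm (Fin (k + 1)) :=
  p.succ.cycleRange.symm * Equiv.Perm.decomposeFin.symm (0, σ) * q.succ.cycleRange

theorem doublePerm_succ (σ : Equiv.Perm (Fin k)) (p q : Fin k) :
    doublePerm σ p q q.succ = p.succ := by
  simp [doublePerm]

theorem doublePerm_succAbove (σ : Equiv.Perm (Fin k)) (p q x : Fin k) :
    doublePerm σ p q (q.succ.succAbove x) = p.succ.succAbove (σ x) := by
  simp [doublePerm]

/-- The two powers of `-1` are the signs of the cycles moving `p.succ` and `q.succ` to the front;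
they later convert one boundary sign into the other. -/
theorem sign_doublePerm (σ : Equiv.Perm (Fin k)) (p q : Fin k) :
    Equiv.Perm.sign (doublePerm σ p q) =
      (-1) ^ ((p : ℕ) + 1) * (-1) ^ ((q : ℕ) + 1) * Equiv.Perm.sign σ := by
  simp only [doublePerm, map_mul, Equiv.Perm.decomposeFin.symm_sign, if_true,
    Fin.sign_cycleRange, Fin.val_succ, one_mul, Equiv.Perm.sign_symm]
  exact mul_right_comm _ _ _

theorem predAbove_doublePerm (σ : Equiv.Perm (Fin k)) (q : Fin k) (x : Fin (k + 1)) :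
    (σ q).predAbove (doublePerm σ (σ q) q x) = σ (q.predAbove x) := by
  rcases Fin.eq_self_or_eq_succAbove q.succ x with rfl | ⟨y, rfl⟩
  · simp [doublePerm_succ]
  · rw [doublePerm_succAbove, predAbove_succ_succAbove, predAbove_succ_succAbove]

/-- Precomposing with `predAbove` doubles the letter of rank `q` in place. Stability ranks the copy
immediately after the original, at `q.succ`, and leaves all other comparisons unchanged. -/
theorem sort_comp_predAbove (c : Fin k → α) (q : Fin k) :
    Tuple.sort (c ∘ (Tuple.sort c q).predAbove) =
      doublePerm (Tuple.sort c) (Tuple.sort c q) q := by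
  obtain ⟨hc, hc'⟩ := Tuple.eq_sort_iff.1 (rfl : Tuple.sort c = Tuple.sort c)
  set σ := Tuple.sort c with hσ
  refine (Tuple.eq_sort_iff.2 ⟨?_, ?_⟩).symm
  · intro i j hij
    simp only [Function.comp_apply, predAbove_doublePerm]
    exact hc (Fin.predAbove_right_monotone q hij)
  · intro i j hij hs
    simp only [Function.comp_apply, predAbove_doublePerm] at hs
    rcases (Fin.predAbove_right_monotone q hij.le).lt_or_eq with h | h
    · have := hc' _ _ h hs
      rw [← predAbove_doublePerm, ← predAbove_doublePerm] at this
      exact lt_of_not_ge fun hle => this.not_ge (Fin.predAbove_right_monotone _ hle)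
    -- `q.predAbove` identifies only `q.castSucc` and `q.succ`, so a tie of ranks occurs for this
    -- one pair.
    · have hi : i = q.succ.succAbove q ∧ j = q.succ := by
        simp only [Fin.ext_iff, OrderedPartition.val_predAbove, Fin.lt_def] at *
        simp [Fin.succAbove, Fin.lt_def]
        split_ifs at h <;> omega
      rw [hi.1, hi.2, doublePerm_succ, doublePerm_succAbove]
      simp [Fin.succAbove, Fin.lt_def]

end Sorting

/-! ### Counting words with a given sorting permutation. -/

theorem card_strictMono (k N : ℕ) :
    Nat.card {g : Fin k → Fin N // StrictMono g} = N.choose k := by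
  have e : {g : Fin k → Fin N // StrictMono g} ≃ (Fin k ↪o Fin N) :=
    { toFun := fun g => OrderEmbedding.ofStrictMono g.1 g.2
      invFun := fun g => ⟨g, g.strictMono⟩
      left_inv := fun g => rfl
      right_inv := fun g => by ext; rfl }
  rw [Nat.card_congr (e.trans Set.powersetCard.ofFinEmbEquiv), Set.powersetCard.card,
    Nat.card_eq_fintype_card, Fintype.card_fin]

/-- Sequences `i_0 ≤ … ≤ i_n` below `t + 1` with `i_s < i_{s+1}` wherever `D s` holds are
counted by a binomial coefficient. -/
theorem card_weaklyIncreasing (n t : ℕ) (D : ℕ → Prop) [DecidablePred D] :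
    Nat.card {i : Fin (n + 1) → Fin (t + 1) //
        ∀ s : Fin n, (i s.castSucc : ℕ) + (if D s then 1 else 0) ≤ i s.succ} =
      (n + 1 + t - n.count D).choose (n + 1) := by
  -- `w a` counts the weak steps before `a`; adding it makes every step strict, at the price of
  -- raising the bound from `t + 1` to `t + 1 + w n`.
  set w : ℕ → ℕ := fun a => a.count fun s => ¬ D s with hw
  have hwD : ∀ a, w a + a.count D = a := by
    intro a
    induction a with
    | zero => simp [hw]
    | succ a ih =>
      simp only [hw, Nat.count_succ] at ih ⊢
      split_ifs <;> omega
  have hws : ∀ a, w (a + 1) + (if D a then 1 else 0) = w a + 1 := by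
    intro a
    simp only [hw, Nat.count_succ]
    split_ifs <;> omega
  have hN : n + 1 + t - n.count D = t + 1 + w n := by
    have := hwD n
    omega
  have hwmono : Monotone w := Nat.count_monotone _
  have hle : ∀ g : {g : Fin (n + 1) → Fin (t + 1 + w n) // StrictMono g}, ∀ a, ∀ h : a < n + 1,
      w a ≤ g.1 ⟨a, h⟩ := by
    intro g a
    induction a with
    | zero => intro h; simp [hw]
    | succ a ih =>
      intro h
      have h1 := ih (by omega)
      have h2 : g.1 ⟨a, by omega⟩ < g.1 ⟨a + 1, h⟩ := g.2 (Fin.lt_def.2 (Nat.lt_succ_self _))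
      have h3 := hws a
      rw [Fin.lt_def] at h2
      omega
  rw [← card_strictMono, hN]
  refine Nat.card_congr
    { toFun := fun i => ⟨fun a => ⟨i.1 a + w a, ?_⟩, ?_⟩
      invFun := fun g => ⟨fun a => ⟨g.1 a - w a, ?_⟩, ?_⟩
      left_inv := fun i => ?_
      right_inv := fun g => ?_ }
  · have := hwmono (Nat.lt_succ_iff.1 a.2)
    have := (i.1 a).2
    omega
  · refine Fin.strictMono_iff_lt_succ.2 fun s => Fin.lt_def.2 ?_
    have h1 := i.2 s
    have h2 := hws s
    simp only [Fin.val_castSucc, Fin.val_succ]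
    omega
  -- `g` gains at least one per step and `w` at most one, so `g - w` is weakly increasing and
  -- bounded by its last value, which is below `t + 1`.
  · have key : ∀ d : ℕ, ∀ h : (a : ℕ) + d < n + 1,
        (g.1 a : ℕ) + w (a + d) ≤ g.1 ⟨a + d, h⟩ + w a := by
      intro d
      induction d with
      | zero => intro h; exact le_rfl
      | succ d ih =>
        intro h
        have h1 := ih (by omega)
        have h2 : g.1 ⟨a + d, by omega⟩ < g.1 ⟨a + (d + 1), h⟩ :=
          g.2 (Fin.lt_def.2 (Nat.lt_succ_self _))
        have h3 := hws (a + d)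
        rw [Fin.lt_def] at h2
        have h4 : w (a + (d + 1)) = w (a + d + 1) := rfl
        omega
    have h := key (n - a) (by omega)
    have h2 := (g.1 ⟨a + (n - a), by omega⟩).2
    have h3 : (a : ℕ) + (n - a) = n := by omega
    have h4 : w (a + (n - a)) = w n := congrArg w h3
    omega
  · intro s
    have h1 : w s ≤ g.1 s.castSucc := hle g s (by omega)
    have h1' : w (s + 1) ≤ g.1 s.succ := hle g (s + 1) (by omega)
    have h2 : g.1 s.castSucc < g.1 s.succ := g.2 (Fin.castSucc_lt_succ)
    have h3 := hws s
    rw [Fin.lt_def] at h2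
    simp only [Fin.val_castSucc, Fin.val_succ]
    omega
  · apply Subtype.ext
    funext a
    simp
  · apply Subtype.ext
    funext a
    apply Fin.ext
    simp only
    exact Nat.sub_add_cancel (hle g a a.2)

theorem des_eq_count {n : ℕ} (π : Equiv.Perm (Fin (n + 1))) (D : ℕ → Prop) [DecidablePred D]
    (hD : ∀ s : Fin n, D s ↔ π s.succ < π s.castSucc) : des π = n.count D := by
  rw [Nat.count_eq_card_filter_range, des]
  symm
  refine Finset.card_bij' (fun s hs => (⟨s, ?_⟩, ⟨s + 1, ?_⟩)) (fun x _ => x.1) ?_ ?_ ?_ ?_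
  · have := (Finset.mem_range.1 (Finset.mem_filter.1 hs).1)
    omega
  · have := (Finset.mem_range.1 (Finset.mem_filter.1 hs).1)
    omega
  · intro s hs
    obtain ⟨h1, h2⟩ := Finset.mem_filter.1 hs
    rw [Finset.mem_range] at h1
    exact Finset.mem_filter.2 ⟨Finset.mem_univ _, rfl, (hD ⟨s, h1⟩).1 h2⟩
  · rintro ⟨x, y⟩ hx
    obtain ⟨-, h1, h2⟩ := Finset.mem_filter.1 hx
    have hxn : (x : ℕ) < n := by have := y.2; simp only at h1; omega
    refine Finset.mem_filter.2 ⟨Finset.mem_range.2 hxn, (hD ⟨x, hxn⟩).2 ?_⟩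
    have : y = (⟨x, hxn⟩ : Fin n).succ := Fin.ext h1
    rw [this] at h2
    exact h2
  · intro s hs
    rfl
  · rintro ⟨x, y⟩ hx
    obtain ⟨-, h1, h2⟩ := Finset.mem_filter.1 hx
    exact Prod.ext rfl (Fin.ext h1.symm)

/-- Here `i` is the word read in the order `π`. Equal neighbours must come from increasing
positions, so a strict increase is forced exactly at the descents of `π`. -/
theorem sort_eq_iff_forall_succ {n t : ℕ} (π : Equiv.Perm (Fin (n + 1)))
    (i : Fin (n + 1) → Fin t) :
    Tuple.sort (i ∘ π.symm) = π ↔ ∀ s : Fin n,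
      (i s.castSucc : ℕ) + (if π s.succ < π s.castSucc then 1 else 0) ≤ i s.succ := by
  have h1 : Tuple.sort (i ∘ π.symm) = π ↔ StrictMono fun a => toLex (i a, π a) := by
    rw [eq_comm, Tuple.eq_sort_iff]
    simp only [Function.comp_apply, Equiv.symm_apply_apply]
    constructor
    · rintro ⟨hm, hs⟩ a b hab
      have hm' : i a ≤ i b := by simpa using hm hab.le
      exact Prod.Lex.toLex_lt_toLex.2
        (hm'.lt_or_eq.imp id fun h => ⟨h, hs a b hab h⟩)
    · intro h
      refine ⟨fun a b hab => ?_, fun a b hab he => ?_⟩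
      · have := Prod.Lex.toLex_le_toLex.1 (h.monotone hab)
        simpa using this.elim le_of_lt fun h => h.1.le
      · exact ((Prod.Lex.toLex_lt_toLex.1 (h hab)).resolve_left he.not_lt).2
  rw [h1, Fin.strictMono_iff_lt_succ]
  refine forall_congr' fun s => ?_
  rw [Prod.Lex.toLex_lt_toLex]
  have hne : π s.castSucc ≠ π s.succ := fun h => (Fin.castSucc_lt_succ (i := s)).ne (π.injective h)
  simp only [Fin.lt_def, Fin.ext_iff, ne_eq] at *
  split_ifs <;> omega

theorem card_sort_eq {k t : ℕ} (π : Equiv.Perm (Fin k)) :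
    Nat.card {c : Fin k → Fin (t + 1) // Tuple.sort c = π} =
      (k + (t + 1) - des π - 1).choose k := by
  classical
  cases k with
  | zero =>
    have : Subsingleton (Equiv.Perm (Fin 0)) := inferInstance
    have : Unique {c : Fin 0 → Fin (t + 1) // Tuple.sort c = π} :=
      { default := ⟨Fin.elim0, Subsingleton.elim _ _⟩
        uniq := fun c => Subtype.ext (Subsingleton.elim _ _) }
    simp
  | succ n =>
    let D : ℕ → Prop := fun s => ∃ h : s < n, π (Fin.succ ⟨s, h⟩) < π (Fin.castSucc ⟨s, h⟩)
    have hD : ∀ s : Fin n, D s ↔ π s.succ < π s.castSucc := fun s =>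
      ⟨fun ⟨_, h⟩ => h, fun h => ⟨s.2, h⟩⟩
    have hk : n + 1 + (t + 1) - des π - 1 = n + 1 + t - des π := by omega
    rw [hk, des_eq_count π D hD, ← card_weaklyIncreasing]
    refine Nat.card_congr (Equiv.subtypeEquiv (Equiv.arrowCongr π.symm (Equiv.refl _)) ?_)
    intro c
    have := sort_eq_iff_forall_succ π (c ∘ π)
    rw [Function.comp_assoc, Equiv.self_comp_symm, Function.comp_id] at this
    rw [this]
    simp only [hD]
    rfl

theorem des_lt {k : ℕ} (π : Equiv.Perm (Fin (k + 1))) : des π < k + 1 := by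
  classical
  let D : ℕ → Prop := fun s => ∃ h : s < k, π (Fin.succ ⟨s, h⟩) < π (Fin.castSucc ⟨s, h⟩)
  have hD : ∀ s : Fin k, D s ↔ π s.succ < π s.castSucc := fun s =>
    ⟨fun ⟨_, h⟩ => h, fun h => ⟨s.2, h⟩⟩
  rw [des_eq_count π D hD]
  exact Nat.lt_succ_of_le (Nat.count_le D)

/-- With a nonempty alphabet, `des π + 1 ≤ k + (t + 1)` holds even for `k = 0`, so the truncated
subtraction agrees with the polynomial. -/
theorem card_sort_eq_eval_binomPoly (F : Type*) [Field F] [CharZero F] {k t : ℕ}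
    (π : Equiv.Perm (Fin k)) :
    (Nat.card {c : Fin k → Fin (t + 1) // Tuple.sort c = π} : F) =
      (binomPoly F k (des π)).eval ((t + 1 : ℕ) : F) := by
  rw [card_sort_eq, eval_binomPoly]
  cases k with
  | zero => simp [des]
  | succ k => have := des_lt π; omega

open Equiv.Perm (sign)

/-! ### The Eulerian idempotents in the group algebra. -/

section GroupAlgebra

variable (F : Type*) [Field F]

/-- The signed sum of the sorting permutations of all words of length `k` in the alphabet `A`. -/
noncomputable def sortSum (k : ℕ) (A : Type*) [LinearOrder A] [Fintype A] :
    MonoidAlgebra F (Equiv.Perm (Fin k)) :=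
  ∑ c : Fin k → A, MonoidAlgebra.single (Tuple.sort c) ((sign (Tuple.sort c) : ℤ) : F)

variable {F}

theorem sortSum_congr {k : ℕ} {A B : Type*} [LinearOrder A] [Fintype A] [LinearOrder B]
    [Fintype B] (e : A ≃o B) : sortSum F k A = sortSum F k B := by
  refine Fintype.sum_equiv (Equiv.arrowCongr (Equiv.refl _) e.toEquiv) _ _ fun c => ?_
  have : Tuple.sort (Equiv.arrowCongr (Equiv.refl (Fin k)) e.toEquiv c) = Tuple.sort c :=
    sort_comp_strictMono c e.strictMono
  rw [this]

theorem sortSum_mul_sortSum {k : ℕ} (A B : Type*) [LinearOrder A] [Fintype A] [LinearOrder B]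
    [Fintype B] : sortSum F k A * sortSum F k B = sortSum F k (B ×ₗ A) := by
  rw [sortSum, sortSum, Finset.sum_mul_sum, ← Finset.sum_product']
  -- The pairing from `sort_mul_sort`; it is invertible because the second components alone recover
  -- the first word and its sorting permutation.
  let e : (Fin k → A) × (Fin k → B) ≃ (Fin k → B ×ₗ A) :=
    { toFun := fun x p => toLex (x.2 ((Tuple.sort x.1).symm p), x.1 p)
      invFun := fun y => (fun p => (ofLex (y p)).2,
        fun p => (ofLex (y (Tuple.sort (fun p => (ofLex (y p)).2) p))).1)
      left_inv := fun x => by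
        ext p
        · rfl
        · simp
      right_inv := fun y => by
        ext p
        simp }
  refine Fintype.sum_equiv e _ _ fun x => ?_
  have : Tuple.sort (e x) = Tuple.sort x.1 * Tuple.sort x.2 := (sort_mul_sort _ _).symm
  rw [this, MonoidAlgebra.single_mul_single, map_mul]
  push_cast
  rfl

theorem sortSum_fin_mul (k s t : ℕ) :
    sortSum F k (Fin s) * sortSum F k (Fin t) = sortSum F k (Fin (s * t)) := by
  rw [sortSum_mul_sortSum]
  refine sortSum_congr (Fintype.orderIsoFinOfCardEq _ ?_).symm
  simp [Lex, mul_comm]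

/-- `sign π • π` in the group algebra. -/
noncomputable def signedPerm (F : Type*) [Field F] {k : ℕ} (π : Equiv.Perm (Fin k)) :
    MonoidAlgebra F (Equiv.Perm (Fin k)) :=
  MonoidAlgebra.single π ((sign π : ℤ) : F)

theorem eulerianIdempotent_eq (k j : ℕ) :
    eulerianIdempotent F k j =
      ∑ π : Equiv.Perm (Fin k), (binomPoly F k (des π)).coeff j • signedPerm F π := by
  simp [eulerianIdempotent, signedPerm, MonoidAlgebra.smul_single]

theorem sortSum_eq [CharZero F] (k t : ℕ) :
    sortSum F k (Fin (t + 1)) = ∑ π : Equiv.Perm (Fin k),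
      (binomPoly F k (des π)).eval ((t + 1 : ℕ) : F) • signedPerm F π := by
  classical
  rw [sortSum, ← Finset.sum_fiberwise (s := Finset.univ)
    (g := fun c : Fin k → Fin (t + 1) => Tuple.sort c)]
  refine Finset.sum_congr rfl fun π _ => ?_
  rw [Finset.sum_congr rfl (g := fun _ => signedPerm F π), Finset.sum_const,
    ← card_sort_eq_eval_binomPoly F π, Nat.card_eq_fintype_card, Fintype.card_subtype,
    Nat.cast_smul_eq_nsmul]
  intro c hc
  rw [(Finset.mem_filter.1 hc).2, signedPerm]

/-- Compare coefficients in two polynomial expressions with values in a vector space. -/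
theorem sum_coeff_smul_eq [CharZero F] {ι κ M : Type*} [Fintype ι] [Fintype κ] [AddCommGroup M]
    [Module F M] (P : ι → F[X]) (a : ι → M) (Q : κ → F[X]) (b : κ → M)
    (h : ∀ t : ℕ, ∑ i, (P i).eval ((t + 1 : ℕ) : F) • a i =
      ∑ i, (Q i).eval ((t + 1 : ℕ) : F) • b i) (j : ℕ) :
    ∑ i, (P i).coeff j • a i = ∑ i, (Q i).coeff j • b i := by
  -- Linear functionals separate points, which reduces the claim to scalar polynomials agreeing at
  -- infinitely many points.
  rw [← sub_eq_zero, ← Module.forall_dual_apply_eq_zero_iff F]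
  intro φ
  have hp : ∑ i, P i * C (φ (a i)) = ∑ i, Q i * C (φ (b i)) := by
    refine Polynomial.eq_of_infinite_eval_eq _ _ ?_
    have hinj : Function.Injective fun t : ℕ => ((t + 1 : ℕ) : F) := fun s t hst => by
      have := Nat.cast_injective hst
      omega
    refine (Set.infinite_range_of_injective hinj).mono ?_
    rintro _ ⟨t, rfl⟩
    have := congrArg φ (h t)
    simpa [eval_finsetSum] using this
  have := congrArg (fun p => p.coeff j) hp
  simp only [finsetSum_coeff, coeff_mul_C] at this
  simp [map_sum, this]

/-- Write `S(t)` for the sorting sum and `e_j` for the idempotent. Comparing coefficients of `t^j`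
in `S(s) S(t) = S(st)` gives `S(s) e_j = s^j e_j`; comparing coefficients of `s^j` in this gives
`e_j e_j = e_j`. -/
theorem isIdempotentElem_eulerianIdempotent [CharZero F] (k j : ℕ) :
    IsIdempotentElem (eulerianIdempotent F k j) := by
  have h1 : ∀ s : ℕ, sortSum F k (Fin (s + 1)) * eulerianIdempotent F k j =
      ((s + 1 : ℕ) : F) ^ j • eulerianIdempotent F k j := by
    intro s
    have := sum_coeff_smul_eq (F := F) (fun π : Equiv.Perm (Fin k) => binomPoly F k (des π))
      (fun π => sortSum F k (Fin (s + 1)) * signedPerm F π)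
      (fun π : Equiv.Perm (Fin k) => (binomPoly F k (des π)).comp (C ((s + 1 : ℕ) : F) * X))
      (fun π => signedPerm F π) (fun t => by
        have h2 := sortSum_eq (F := F) k (s * t + s + t)
        have h3 : (s + 1) * (t + 1) = s * t + s + t + 1 := by ring
        rw [← h3, ← sortSum_fin_mul, sortSum_eq k t, Finset.mul_sum] at h2
        simpa [mul_smul_comm] using h2) j
    simp only [comp_C_mul_X_coeff] at this
    rw [eulerianIdempotent_eq, Finset.mul_sum, Finset.smul_sum]
    simp only [mul_smul_comm, smul_smul]
    rw [this]
    exact Finset.sum_congr rfl fun π _ => by rw [mul_comm]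
  have := sum_coeff_smul_eq (F := F) (fun π : Equiv.Perm (Fin k) => binomPoly F k (des π))
    (fun π => signedPerm F π * eulerianIdempotent F k j)
    (fun _ : Unit => (X : F[X]) ^ j) (fun _ => eulerianIdempotent F k j) (fun t => by
      have h2 := h1 t
      rw [sortSum_eq, Finset.sum_mul] at h2
      simpa [smul_mul_assoc] using h2) j
  simp only [← smul_mul_assoc, ← Finset.sum_mul, ← eulerianIdempotent_eq] at this
  have h2 : eulerianIdempotent F k j * eulerianIdempotent F k j = eulerianIdempotent F k j := by
    simpa using this
  exact h2

end GroupAlgebra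

/-! ### Compatibility of the boundary map with the idempotents. -/

section Boundary

variable {F : Type*} [Field F] {V : Type*} {m : ℕ} (G : Fin m → SimpleGraph V)

theorem asAlgebraHom_signedPerm_single {k : ℕ} (π : Equiv.Perm (Fin k)) (B : interFaces G k)
    (a : F) : (chainRep F G k).asAlgebraHom (signedPerm F π) (Finsupp.single B a) =
      ((sign π : ℤ) : F) • Finsupp.single (π • B) a := by
  rw [signedPerm, Representation.asAlgebraHom_single]
  simp [chainRep]

/-- The face obtained by merging two consecutive blocks. -/
def mergeFace {G : Fin m → SimpleGraph V} {k : ℕ} (p : Fin k) (B : interFaces G (k + 1)) :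
    interFaces G k :=
  ⟨B.1.merge p, merge_mem_interFaces p B.2⟩

theorem mergeFace_swap_smul {G : Fin m → SimpleGraph V} {k : ℕ} (p : Fin k)
    (B : interFaces G (k + 1)) :
    mergeFace p (Equiv.swap p.castSucc p.succ • B) = mergeFace p B := by
  apply Subtype.ext
  apply Subtype.ext
  funext v
  change p.predAbove (Equiv.swap p.castSucc p.succ (B.1.1 v)) = p.predAbove (B.1.1 v)
  rw [Equiv.swap_apply_def]
  split_ifs with h1 h2
  · rw [h1]; simp
  · rw [h2]; simp
  · rfl

theorem mergeFace_doublePerm_smul {G : Fin m → SimpleGraph V} {k : ℕ} (σ : Equiv.Perm (Fin k))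
    (q : Fin k) (B : interFaces G (k + 1)) :
    mergeFace (σ q) (doublePerm σ (σ q) q • B) = σ • mergeFace q B := by
  apply Subtype.ext
  apply Subtype.ext
  funext v
  exact predAbove_doublePerm σ q (B.1.1 v)

/-- On the left, terms are pairs of a word `c` and a merging position `p`. Those with `c_p ≠
c_{p+1}` cancel; the others are words with a doubled letter, and removing the copy yields the terms
on the right. -/
theorem boundary_comp_sortSum (k t : ℕ) :
    boundary F G k ∘ₗ (chainRep F G (k + 1)).asAlgebraHom (sortSum F (k + 1) (Fin t)) =
      (chainRep F G k).asAlgebraHom (sortSum F k (Fin t)) ∘ₗ boundary F G k := by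
  classical
  refine Finsupp.lhom_ext' fun B => LinearMap.ext_ring ?_
  let T : (Fin (k + 1) → Fin t) × Fin k → Chain F G k := fun x =>
    ((-1 : F) ^ ((x.2 : ℕ) + 1) * ((sign (Tuple.sort x.1) : ℤ) : F)) •
      Finsupp.single (mergeFace x.2 (Tuple.sort x.1 • B)) 1
  have hL : (boundary F G k ∘ₗ (chainRep F G (k + 1)).asAlgebraHom (sortSum F (k + 1) (Fin t)))
      (Finsupp.single B 1) = ∑ x, T x := by
    rw [Fintype.sum_prod_type]
    simp only [LinearMap.comp_apply, sortSum, map_sum, LinearMap.sum_apply]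
    refine Finset.sum_congr rfl fun c _ => ?_
    have := asAlgebraHom_signedPerm_single (F := F) G (Tuple.sort c) B 1
    rw [signedPerm] at this
    rw [this, map_smul, boundary_single, Finset.smul_sum]
    refine Finset.sum_congr rfl fun p _ => ?_
    rw [smul_smul, mul_comm]
    rfl
  have hR : ((chainRep F G k).asAlgebraHom (sortSum F k (Fin t)) ∘ₗ boundary F G k)
      (Finsupp.single B 1) = ∑ y : (Fin k → Fin t) × Fin k,
        ((-1 : F) ^ ((y.2 : ℕ) + 1) * ((sign (Tuple.sort y.1) : ℤ) : F)) •
          Finsupp.single (Tuple.sort y.1 • mergeFace y.2 B) 1 := by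
    rw [Fintype.sum_prod_type]
    rw [LinearMap.comp_apply, boundary_single, sortSum, map_sum (chainRep F G k).asAlgebraHom,
      LinearMap.sum_apply]
    refine Finset.sum_congr rfl fun c _ => ?_
    rw [map_sum]
    refine Finset.sum_congr rfl fun p _ => ?_
    have := asAlgebraHom_signedPerm_single (F := F) G (Tuple.sort c) (mergeFace p B) 1
    rw [signedPerm] at this
    rw [map_smul]
    erw [this]
    rw [smul_smul]
  -- Exchanging the two letters changes the sorting permutation by a transposition of the two blocks
  -- about to be merged: same face, opposite sign.
  have hcancel : ∑ x with ¬ x.1 x.2.castSucc = x.1 x.2.succ, T x = 0 := by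
    refine Finset.sum_involution
      (fun x _ => (x.1 ∘ Equiv.swap x.2.castSucc x.2.succ, x.2)) ?_ ?_ ?_ ?_
    · rintro ⟨c, p⟩ hx
      have hne := (Finset.mem_filter.1 hx).2
      have hsign : sign (Equiv.swap p.castSucc p.succ) = -1 :=
        Equiv.Perm.sign_swap (Fin.castSucc_lt_succ (i := p)).ne
      simp only [T, sort_comp_swap c p hne, mul_smul _ _ B, mergeFace_swap_smul, map_mul, hsign]
      rw [← add_smul]
      convert zero_smul F _
      simp
    · rintro ⟨c, p⟩ hx _ heq
      have hne := (Finset.mem_filter.1 hx).2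
      have := congrFun (congrArg Prod.fst heq) p.castSucc
      simp only [Function.comp_apply, Equiv.swap_apply_left] at this
      exact hne this.symm
    · rintro ⟨c, p⟩ hx
      have hne := (Finset.mem_filter.1 hx).2
      simpa [eq_comm] using hne
    · rintro ⟨c, p⟩ hx
      simp [Function.comp_assoc, ← Equiv.coe_trans]
  have hmain : ∑ x with x.1 x.2.castSucc = x.1 x.2.succ, T x =
      ∑ y : (Fin k → Fin t) × Fin k,
        ((-1 : F) ^ ((y.2 : ℕ) + 1) * ((sign (Tuple.sort y.1) : ℤ) : F)) •
          Finsupp.single (Tuple.sort y.1 • mergeFace y.2 B) 1 := by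
    symm
    -- On the right, position `q` is taken after sorting; it corresponds to the position `Tuple.sort
    -- c q` in the unsorted word, where the letter is doubled.
    refine Finset.sum_bij'
      (fun y _ => (y.1 ∘ (Tuple.sort y.1 y.2).predAbove, Tuple.sort y.1 y.2))
      (fun x _ => (x.1 ∘ x.2.succ.succAbove,
        (Tuple.sort (x.1 ∘ x.2.succ.succAbove)).symm x.2)) ?_ ?_ ?_ ?_ ?_
    · rintro ⟨c, q⟩ -
      simp
    · intro x _
      exact Finset.mem_univ _
    · rintro ⟨c, q⟩ -
      have key : ∀ p : Fin k, p.predAbove ∘ p.succ.succAbove = id := fun p =>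
        funext (predAbove_succ_succAbove p)
      simp only [Function.comp_assoc, key, Function.comp_id, Equiv.symm_apply_apply]
    · rintro ⟨c, p⟩ hx
      have he := (Finset.mem_filter.1 hx).2
      simp only [Equiv.apply_symm_apply, Prod.mk.injEq, and_true]
      funext y
      rcases Fin.eq_self_or_eq_succAbove p.succ y with rfl | ⟨y, rfl⟩
      · have h1 : p.succ.succAbove p = p.castSucc := by
          simp [Fin.succAbove, Fin.lt_def]
        simpa only [Function.comp_apply, Fin.predAbove_succ_self, h1] using he
      · simp only [Function.comp_apply, predAbove_succ_succAbove]
    · rintro ⟨c, q⟩ -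
      simp only [T, sort_comp_predAbove, mergeFace_doublePerm_smul, sign_doublePerm]
      congr 1
      push_cast
      have : ((-1 : F) ^ ((Tuple.sort c q : ℕ) + 1)) * (-1) ^ ((Tuple.sort c q : ℕ) + 1) = 1 := by
        rw [← mul_pow]; simp
      linear_combination
        -((-1 : F) ^ ((q : ℕ) + 1) * ((sign (Tuple.sort c) : ℤ) : F)) * this
  calc _ = ∑ x, T x := hL
    _ = _ := by rw [← Finset.sum_filter_add_sum_filter_not _
                  (fun x : (Fin (k + 1) → Fin t) × Fin k => x.1 x.2.castSucc = x.1 x.2.succ) T,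
                  hcancel, add_zero, hmain]
    _ = _ := hR.symm

theorem comp_sum_smul {ι L M N : Type*} [AddCommGroup L] [Module F L] [AddCommGroup M]
    [Module F M] [AddCommGroup N] [Module F N] (s : Finset ι) (a : ι → F) (f : M →ₗ[F] N)
    (g : ι → L →ₗ[F] M) : f ∘ₗ ∑ i ∈ s, a i • g i = ∑ i ∈ s, a i • f ∘ₗ g i :=
  LinearMap.ext fun x => by simp [LinearMap.sum_apply, map_sum]

theorem sum_smul_comp {ι L M N : Type*} [AddCommGroup L] [Module F L] [AddCommGroup M]
    [Module F M] [AddCommGroup N] [Module F N] (s : Finset ι) (a : ι → F) (f : ι → M →ₗ[F] N)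
    (g : L →ₗ[F] M) : (∑ i ∈ s, a i • f i) ∘ₗ g = ∑ i ∈ s, a i • f i ∘ₗ g :=
  LinearMap.ext fun x => by simp [LinearMap.sum_apply]

theorem boundary_comp_eulerianIdempotent [CharZero F] (k j : ℕ) :
    boundary F G k ∘ₗ (chainRep F G (k + 1)).asAlgebraHom (eulerianIdempotent F (k + 1) j) =
      (chainRep F G k).asAlgebraHom (eulerianIdempotent F k j) ∘ₗ boundary F G k := by
  have := sum_coeff_smul_eq (F := F)
    (fun π : Equiv.Perm (Fin (k + 1)) => binomPoly F (k + 1) (des π))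
    (fun π => boundary F G k ∘ₗ (chainRep F G (k + 1)).asAlgebraHom (signedPerm F π))
    (fun π : Equiv.Perm (Fin k) => binomPoly F k (des π))
    (fun π => (chainRep F G k).asAlgebraHom (signedPerm F π) ∘ₗ boundary F G k) (fun t => by
      have h := boundary_comp_sortSum (F := F) G k (t + 1)
      rw [sortSum_eq, sortSum_eq] at h
      simpa only [map_sum, map_smul, comp_sum_smul, sum_smul_comp] using h) j
  simpa only [eulerianIdempotent_eq, map_sum, map_smul, comp_sum_smul, sum_smul_comp] using this

theorem map_boundary_hodgeChain_le [CharZero F] (j k : ℕ) :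
    (hodgeChain F G j (k + 1)).map (boundary F G k) ≤ hodgeChain F G j k := by
  rw [hodgeChain, ← LinearMap.range_comp, boundary_comp_eulerianIdempotent]
  exact LinearMap.range_comp_le_range _ _

end Boundary

/-! ### Dimensions of the Hodge pieces. -/

section Dimension

instance {V : Type*} [Finite V] (k : ℕ) : Finite (OrderedPartition V k) :=
  inferInstanceAs (Finite {f : V → Fin k // Function.Surjective f})

variable {F : Type*} [Field F] {V : Type*} {m : ℕ} (G : Fin m → SimpleGraph V)

/-- The action is free because all blocks are nonempty. This kills every diagonal entry for `π ≠ 1`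
in the trace. -/
theorem smul_interFaces_eq_iff {k : ℕ} (π : Equiv.Perm (Fin k)) (B : interFaces G k) :
    π • B = B ↔ π = 1 := by
  refine ⟨fun h => ?_, fun h => h ▸ one_smul _ B⟩
  ext p
  obtain ⟨v, rfl⟩ := B.1.2 p
  exact congrArg Fin.val (congrFun (congrArg Subtype.val (congrArg Subtype.val h)) v)

theorem trace_signedPerm [Finite V] {k : ℕ} (π : Equiv.Perm (Fin k)) :
    LinearMap.trace F (Chain F G k) ((chainRep F G k).asAlgebraHom (signedPerm F π)) =
      if π = 1 then (Nat.card (interFaces G k) : F) else 0 := by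
  classical
  have := Fintype.ofFinite (interFaces G k)
  rw [LinearMap.trace_eq_matrix_trace F Finsupp.basisSingleOne, Matrix.trace]
  simp only [Matrix.diag_apply, LinearMap.toMatrix_apply, Finsupp.coe_basisSingleOne,
    asAlgebraHom_signedPerm_single, Finsupp.basisSingleOne_repr, LinearEquiv.refl_apply,
    Finsupp.smul_apply, Finsupp.single_apply, smul_interFaces_eq_iff]
  split_ifs with h
  · simp [h]
  · simp

theorem des_one (k : ℕ) : des (1 : Equiv.Perm (Fin k)) = 0 := by
  rw [des, Finset.card_eq_zero, Finset.filter_eq_empty_iff]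
  rintro ⟨x, y⟩ - ⟨h1, h2⟩
  simp only [Equiv.Perm.one_apply, Fin.lt_def] at h1 h2
  omega

/-- The rank of an idempotent is its trace, to which only the identity permutation contributes. -/
theorem finrank_hodgeChain [CharZero F] [Finite V] (j k : ℕ) :
    (Module.finrank F (hodgeChain F G j k) : F) =
      Nat.card (interFaces G k) * (binomPoly F k 0).coeff j := by
  have hid : IsIdempotentElem ((chainRep F G k).asAlgebraHom (eulerianIdempotent F k j)) :=
    (isIdempotentElem_eulerianIdempotent k j).map _
  have := Module.Free.of_divisionRing F
    (LinearMap.range ((chainRep F G k).asAlgebraHom (eulerianIdempotent F k j)))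
  have := Module.Free.of_divisionRing F
    (LinearMap.ker ((chainRep F G k).asAlgebraHom (eulerianIdempotent F k j)))
  rw [hodgeChain, ← ((LinearMap.isProj_range_iff_isIdempotentElem _).2 hid).trace,
    eulerianIdempotent_eq, map_sum, map_sum]
  simp [trace_signedPerm, des_one, mul_comm]

theorem card_interFaces_zero [Nonempty V] : Nat.card (interFaces G 0) = 0 := by
  have : IsEmpty (interFaces G 0) := ⟨fun B => (B.1.1 (Classical.arbitrary V)).elim0⟩
  exact Nat.card_of_isEmpty

/-- A block containing an edge has two vertices, which leaves room for fewer than `Nat.card V`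
blocks. -/
theorem isEmpty_interFaces [Finite V] (hm : 1 ≤ m) {k : ℕ} (hk : Nat.card V ≤ k) :
    IsEmpty (interFaces G k) := by
  refine ⟨fun B => ?_⟩
  have := Fintype.ofFinite V
  obtain ⟨p, v, hv, w, hw, h⟩ := Set.mem_iInter.1 B.2 ⟨0, hm⟩
  have hcard : Fintype.card V = Fintype.card (Fin k) := by
    refine le_antisymm ?_ (Fintype.card_le_of_surjective _ B.1.2)
    simpa using hk
  have hinj := ((Fintype.bijective_iff_surjective_and_card _).2 ⟨B.1.2, hcard⟩).1
  exact h.ne (hinj (Eq.trans hv (Eq.symm hw)))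

end Dimension

/-! ### Counting colorings and the Euler characteristic of chains. -/

section Colorings

variable {V : Type*} [Fintype V] {m : ℕ} (G : Fin m → SimpleGraph V)

/-- Colorings that are improper for every `G_i` are given by their set of `k` colors and the
ordered partition of `V` into color classes. -/
theorem card_improper (hm : 1 ≤ m) (q : ℕ) :
    Nat.card {c : V → Fin q // ¬ ∃ i, ∀ v w, (G i).Adj v w → c v ≠ c w} =
      ∑ k ∈ Finset.range (Fintype.card V), Nat.card (interFaces G k) * q.choose k := by
  classical
  have hbad : ∀ c : V → Fin q, (¬ ∃ i, ∀ v w, (G i).Adj v w → c v ≠ c w) ↔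
      ∀ i, ∃ v w, (G i).Adj v w ∧ c v = c w := by
    intro c
    push Not
    rfl
  let T := Σ k : Fin (Fintype.card V), interFaces G k × {g : Fin k → Fin q // StrictMono g}
  let φ : T → {c : V → Fin q // ¬ ∃ i, ∀ v w, (G i).Adj v w → c v ≠ c w} := fun x =>
    ⟨fun v => x.2.2.1 (x.2.1.1.1 v), (hbad _).2 fun i => by
      obtain ⟨p, v, hv, w, hw, h⟩ := Set.mem_iInter.1 x.2.1.2 i
      exact ⟨v, w, h, congrArg x.2.2.1 (Eq.trans hv (Eq.symm hw))⟩⟩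
  have himage : ∀ x : T, Finset.univ.image (φ x).1 = Finset.univ.image x.2.2.1 := by
    intro x
    ext a
    simp only [Finset.mem_image, Finset.mem_univ, true_and]
    constructor
    · rintro ⟨v, rfl⟩
      exact ⟨_, rfl⟩
    · rintro ⟨p, rfl⟩
      obtain ⟨v, rfl⟩ := x.2.1.1.2 p
      exact ⟨v, rfl⟩
  have hinj : Function.Injective φ := by
    intro x y hxy
    -- The set of colors used determines `k` and its increasing enumeration `g`; injectivity of `g`
    -- then determines the partition.
    have hs : Finset.univ.image x.2.2.1 = Finset.univ.image y.2.2.1 := by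
      rw [← himage, ← himage, hxy]
    obtain ⟨⟨k, hk⟩, ⟨B, hB⟩, ⟨g, hg⟩⟩ := x
    obtain ⟨⟨k', hk'⟩, ⟨B', hB'⟩, ⟨g', hg'⟩⟩ := y
    dsimp only at hs B B' g g' hB hB'
    have hkk : k = k' := by
      have := congrArg Finset.card hs
      rwa [Finset.card_image_of_injective _ hg.injective,
        Finset.card_image_of_injective _ hg'.injective, Finset.card_fin, Finset.card_fin] at this
    subst hkk
    have hgg : g = g' := by
      have hc : (Finset.univ.image g).card = k := by
        rw [Finset.card_image_of_injective _ hg.injective, Finset.card_fin]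
      exact (Finset.orderEmbOfFin_unique hc
        (fun x => Finset.mem_image_of_mem _ (Finset.mem_univ _)) hg).trans
          (Finset.orderEmbOfFin_unique hc
            (fun x => hs ▸ Finset.mem_image_of_mem _ (Finset.mem_univ _)) hg').symm
    subst hgg
    have hBB : B = B' := by
      apply Subtype.ext
      funext v
      exact hg.injective (congrFun (congrArg Subtype.val hxy) v)
    subst hBB
    rfl
  have hsurj : Function.Surjective φ := by
    rintro ⟨c, hc⟩
    have hc' := (hbad c).1 hc
    obtain ⟨v, w, hvw, he⟩ := hc' ⟨0, hm⟩
    -- A monochromatic edge of `G_0` makes `c` non-injective.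
    have hlt : (Finset.univ.image c).card < Fintype.card V := by
      refine lt_of_le_of_ne Finset.card_image_le fun h => ?_
      have := Finset.card_image_iff.1 h
      exact hvw.ne (this (Finset.mem_coe.2 (Finset.mem_univ v))
        (Finset.mem_coe.2 (Finset.mem_univ w)) he)
    let e := (Finset.univ.image c).orderIsoOfFin rfl
    let f : V → Fin (Finset.univ.image c).card := fun v =>
      e.symm ⟨c v, Finset.mem_image_of_mem c (Finset.mem_univ v)⟩
    have hf : Function.Surjective f := by
      intro p
      obtain ⟨v, -, hv⟩ := Finset.mem_image.1 (e p).2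
      exact ⟨v, e.symm_apply_eq.2 (Subtype.ext hv)⟩
    refine ⟨⟨⟨_, hlt⟩, ⟨⟨f, hf⟩, Set.mem_iInter.2 fun i => ?_⟩,
      ⟨fun p => e p, fun p p' h => e.strictMono h⟩⟩, ?_⟩
    · obtain ⟨v, w, hvw, he⟩ := hc' i
      refine ⟨f v, v, rfl, w, ?_, hvw⟩
      change f w = f v
      simp only [f, he]
    · apply Subtype.ext
      funext v
      simp [φ, f]
  rw [← Nat.card_congr (Equiv.ofBijective φ ⟨hinj, hsurj⟩)]
  rw [Nat.card_sigma, Finset.sum_range]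
  refine Finset.sum_congr rfl fun k _ => ?_
  rw [Nat.card_prod, card_strictMono]

theorem numColorings_add (hm : 1 ≤ m) (q : ℕ) :
    numColorings G q + ∑ k ∈ Finset.range (Fintype.card V),
      Nat.card (interFaces G k) * q.choose k = q ^ Fintype.card V := by
  classical
  rw [← card_improper G hm, numColorings, Nat.card_eq_fintype_card, Nat.card_eq_fintype_card,
    Fintype.card_subtype_compl]
  rw [Nat.add_sub_cancel' (Fintype.card_subtype_le _)]
  simp

variable {F : Type*} [Field F] [CharZero F]

/-- The reciprocity `binom(k + t - 1, k) = (-1)^k binom(-t, k)`; it is the source of the argument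
`-λ` in the final formula. -/
theorem binomPoly_zero (k : ℕ) :
    binomPoly F k 0 = C ((-1) ^ k * (k.factorial : F)⁻¹) * (descPochhammer F k).comp (-X) := by
  refine Polynomial.funext fun r => ?_
  have h := ascPochhammer_eval_neg_eq_descPochhammer F (-r) k
  have h' := descPochhammer_eval_eq_ascPochhammer F (r + ((k : F) - 1)) k
  rw [neg_neg] at h
  have h2 : r + ((k : F) - 1) - k + 1 = r := by ring
  rw [h2, h] at h'
  simp [binomPoly, eval_comp, h']
  ring

theorem map_chromaticPolynomial (hm : 1 ≤ m) :
    (chromaticPolynomial G).map (Int.castRingHom F) = X ^ Fintype.card V -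
      ∑ k ∈ Finset.range (Fintype.card V),
        C ((Nat.card (interFaces G k) : F) * (k.factorial : F)⁻¹) * descPochhammer F k := by
  refine Polynomial.eq_of_infinite_eval_eq _ _ ?_
  refine (Set.infinite_range_of_injective (Nat.cast_injective (R := F))).mono ?_
  rintro _ ⟨q, rfl⟩
  have h1 := (eq_chromaticPolynomial_iff G _).1 rfl q
  have h2 := congrArg (fun z : ℕ => (z : F)) (numColorings_add G hm q)
  have h3 : eval (q : F) ((chromaticPolynomial G).map (Int.castRingHom F)) = numColorings G q := by
    have := congrArg (Int.castRingHom F) h1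
    rw [← Polynomial.eval_map_apply] at this
    simpa using this
  simp only [Set.mem_ofPred_eq, h3, eval_sub, eval_pow, eval_X, eval_finsetSum, eval_mul, eval_C,
    descPochhammer_eval_eq_descFactorial, Nat.descFactorial_eq_factorial_mul_choose]
  push_cast at h2
  rw [← h2, eq_sub_iff_add_eq]
  congr 1
  refine Finset.sum_congr rfl fun k _ => ?_
  have : (k.factorial : F) ≠ 0 := by exact_mod_cast k.factorial_ne_zero
  push_cast
  field_simp

theorem hodgeEulerChar_eq_coeff (hm : 1 ≤ m) [Nonempty V] (j : ℕ) :
    hodgeEulerChar F G j =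
      -((chromaticPolynomial G).comp (-X) - (-X) ^ Fintype.card V).coeff j := by
  apply Int.cast_injective (α := F)
  have hL : ((hodgeEulerChar F G j : ℤ) : F) = ∑ k ∈ Finset.range (Fintype.card V),
      (-1) ^ k * (Nat.card (interFaces G k) * (binomPoly F k 0).coeff j) := by
    obtain ⟨n, hn⟩ : ∃ n, Fintype.card V = n + 1 :=
      ⟨_, (Nat.succ_pred_eq_of_pos Fintype.card_pos).symm⟩
    -- The chain sum starts at one block and the coloring sum at zero blocks; the extra term
    -- vanishes since `V` is nonempty.
    rw [hodgeEulerChar, hn, Finset.sum_range_succ', card_interFaces_zero]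
    push_cast
    simp only [finrank_hodgeChain]
    simp
  have hR : ((-((chromaticPolynomial G).comp (-X) - (-X) ^ Fintype.card V).coeff j : ℤ) : F) =
      -((((chromaticPolynomial G).map (Int.castRingHom F)).comp (-X) -
        (-X) ^ Fintype.card V).coeff j) := by
    have : ((chromaticPolynomial G).map (Int.castRingHom F)).comp (-X) - (-X) ^ Fintype.card V =
        ((chromaticPolynomial G).comp (-X) - (-X) ^ Fintype.card V).map (Int.castRingHom F) := by
      simp [Polynomial.map_comp]
    rw [this, coeff_map]
    simp
  rw [hL, hR, map_chromaticPolynomial G hm]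
  simp only [sub_comp, pow_comp, X_comp, sub_sub_cancel_left, Polynomial.sum_comp, coeff_neg, neg_neg,
    finsetSum_coeff, mul_comp, C_comp, coeff_C_mul]
  refine Finset.sum_congr rfl fun k _ => ?_
  rw [binomPoly_zero, coeff_C_mul]
  have : ((-1 : F) ^ k) * (-1) ^ k = 1 := by rw [← mul_pow]; simp
  linear_combination (Nat.card (interFaces G k) * (k.factorial : F)⁻¹ *
    ((descPochhammer F k).comp (-X)).coeff j) * this

end Colorings

/-! ### The Euler characteristic of homology. -/

section Homology

variable {F : Type*} [Field F] [CharZero F] {V : Type*} [Fintype V] {m : ℕ}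
  (G : Fin m → SimpleGraph V)

theorem finrank_subquotient_add_finrank {F M : Type*} [Field F] [AddCommGroup M] [Module F M]
    [Module.Finite F M] {Z B : Submodule F M} (h : B ≤ Z) :
    Module.finrank F (Subquotient Z B) + Module.finrank F B = Module.finrank F Z := by
  rw [← (Submodule.submoduleOfEquivOfLe h).finrank_eq]
  exact Submodule.finrank_quotient_add_finrank (B.submoduleOf Z)

theorem finrank_map_add_finrank_inf_ker {F M N : Type*} [Field F] [AddCommGroup M] [Module F M]
    [AddCommGroup N] [Module F N] [Module.Finite F M] (f : M →ₗ[F] N) (S : Submodule F M) :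
    Module.finrank F (S.map f) + Module.finrank F ↥(S ⊓ LinearMap.ker f) =
      Module.finrank F S := by
  have h : S ⊓ LinearMap.ker f = (LinearMap.ker (f.domRestrict S)).map S.subtype := by
    ext x
    simp [and_comm]
  rw [h, ← (Submodule.equivMapOfInjective _ S.injective_subtype _).finrank_eq,
    ← LinearMap.range_domRestrict, LinearMap.finrank_range_add_finrank_ker]

/-- The rank of the boundary map on the `j`-th Hodge piece. -/
noncomputable def boundaryRank (F : Type*) [Field F] {V : Type*} {m : ℕ}
    (G : Fin m → SimpleGraph V) (j k : ℕ) : ℕ :=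
  Module.finrank F ((hodgeChain F G j (k + 1)).map (boundary F G k))

theorem finrank_hodgeHomology (j k : ℕ) :
    (Module.finrank F (HodgeHomology F G j k) : ℤ) =
      Module.finrank F (hodgeChain F G j (k + 1)) - boundaryRank F G j k -
        boundaryRank F G j (k + 1) := by
  have hle : hodgeBoundaries F G j k ≤ hodgeCycles F G j k := by
    refine le_inf (map_boundary_hodgeChain_le G j (k + 1)) ?_
    rintro _ ⟨x, -, rfl⟩
    exact LinearMap.congr_fun (boundary_comp_boundary F G k) x
  have h1 : Module.finrank F (HodgeHomology F G j k) + boundaryRank F G j (k + 1) =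
      Module.finrank F (hodgeCycles F G j k) := finrank_subquotient_add_finrank hle
  have h2 : boundaryRank F G j k + Module.finrank F (hodgeCycles F G j k) =
      Module.finrank F (hodgeChain F G j (k + 1)) :=
    finrank_map_add_finrank_inf_ker (boundary F G k) (hodgeChain F G j (k + 1))
  rw [← h2, ← h1]
  push_cast
  ring

/-- Each boundary rank is subtracted in two adjacent degrees with opposite signs, so only the two
extreme ranks survive. The lowest is that of an empty sum of merges, and the highest starts from
partitions into `Fintype.card V` blocks, none of which is a face. -/
theorem hodgeEulerChar_eq_homology (hm : 1 ≤ m) [Nonempty V] (j : ℕ) :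
    hodgeEulerChar F G j = ∑ k ∈ Finset.range (Fintype.card V - 1),
      (-1) ^ (k + 1) * (Module.finrank F (HodgeHomology F G j k) : ℤ) := by
  have h0 : boundaryRank F G j 0 = 0 := by
    have : boundary F G 0 = 0 := by simp [boundary]
    simp [boundaryRank, this]
  have htop : boundaryRank F G j (Fintype.card V - 1) = 0 := by
    have hV : Fintype.card V - 1 + 1 = Fintype.card V := Nat.sub_add_cancel Fintype.card_pos
    have := isEmpty_interFaces G hm (k := Fintype.card V - 1 + 1) (by simp [hV])
    have hbot : hodgeChain F G j (Fintype.card V - 1 + 1) = ⊥ := Subsingleton.elim _ _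
    rw [boundaryRank, hbot, Submodule.map_bot, finrank_bot]
  have htel : ∀ N : ℕ, ∑ k ∈ Finset.range N, (-1 : ℤ) ^ (k + 1) *
      (Module.finrank F (HodgeHomology F G j k) : ℤ) =
        ∑ k ∈ Finset.range N, (-1) ^ (k + 1) * (Module.finrank F (hodgeChain F G j (k + 1)) : ℤ) +
          (-1) ^ (N + 1) * boundaryRank F G j N := by
    intro N
    induction N with
    | zero => simp [h0]
    | succ N ih =>
      rw [Finset.sum_range_succ, Finset.sum_range_succ, ih, finrank_hodgeHomology]
      ring
  rw [htel, htop, hodgeEulerChar]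
  simp

end Homology

end ColoringComplex

open ColoringComplex in
theorem mainTheorem1 {F : Type*} [Field F] [CharZero F] {V : Type*} [Fintype V]
    {m : ℕ} (hm : 1 ≤ m) (G : Fin m → SimpleGraph V) (hG : ∀ i, (G i).edgeSet.Nonempty) :
    (∀ j k : ℕ, (hodgeChain F G j (k + 1)).map (boundary F G k) ≤ hodgeChain F G j k) ∧
    ∀ j : ℕ,
      hodgeEulerChar F G j =
        -((chromaticPolynomial G).comp (-Polynomial.X) -
            (-Polynomial.X) ^ Fintype.card V).coeff j ∧
      hodgeEulerChar F G j =
        ∑ k ∈ Finset.range (Fintype.card V - 1),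
          (-1) ^ (k + 1) * (Module.finrank F (HodgeHomology F G j k) : ℤ) := by
  obtain ⟨e, -⟩ := hG ⟨0, hm⟩
  have : Nonempty V := ⟨e.out.1⟩
  exact ⟨fun j k => map_boundary_hodgeChain_le G j k,
    fun j => ⟨hodgeEulerChar_eq_coeff G hm j, hodgeEulerChar_eq_homology G hm j⟩⟩
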